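/- Let $n\ge 1$ and let $w_1,\dots,w_n\in\mathbb R^n$ be linearly independent unit vectors. A (polyhedral) cone is the set $\mathfrak c(u_1,\dots,u_d)$ of all linear combinations with nonnegative coefficients of finitely many vectors $u_1,\dots,u_d\in\mathbb R^n$; it contains lines if it contains $\mathbb R u$ for some $u\neq 0$; its dimension is that of its linear span; $[C]$ denotes the indicator function of a cone $C$; and $\langle\,\cdot\,\rangle$ denotes linear span. Then there are finitely many cones $C_1,\dots,C_N$ in $\mathbb R^n$ and signs $s_1,\dots,s_N\in\{\pm1\}$ such that $$[\mathfrak c(w_1,\dots,w_n)]\equiv\sum_{m=1}^N s_m[C_m]$$ modulo the additive group generated by the indicator functions of cones containing lines, and each $C_m$ is either (I) a cone containing lines, or (II) a cone $\mathfrak c(v_1,\dots,v_n)$ of dimension $n$ whose associated matrix $M_n$, the $n\times n$ matrix with diagonal entries $1$ and $(i,j)$ entry $-|v_i\cdot v_j|$ for $i\ne j$, is positive definite, where moreover (a) $\|v_i\|=1$ for $i=1,\dots,n$; (b) $v_n=w_n$; (c) $\langle v_1,\dots,v_{n-1}\rangle=\langle w_1,\dots,w_{n-1}\rangle$; (d)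 $v_i\cdot v_n=0$ for $i=1,\dots,n-2$; (e) there are $\epsilon_1,\dots,\epsilon_n\in\{\pm1\}$ such that $x^TM_nx=\big\|\sum_{i=1}^n x_i\,\epsilon_iv_i\big\|^2$ for every $x\in\mathbb R^n$. -/

import Mathlib

/-- The cone `𝔠(v₁, …, v_d)` generated by a finite list of vectors of `ℝⁿ`: all their linear
combinations with nonnegative coefficients. -/
def genCone {n d : ℕ} (v : Fin d → EuclideanSpace ℝ (Fin n)) :
    PointedCone ℝ (EuclideanSpace ℝ (Fin n)) :=
  PointedCone.hull ℝ (Set.range v)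

/-- A polyhedral cone in `ℝⁿ`: the conic hull of finitely many vectors. -/
def IsPolyhedralCone {n : ℕ} (K : PointedCone ℝ (EuclideanSpace ℝ (Fin n))) : Prop :=
  ∃ s : Finset (EuclideanSpace ℝ (Fin n)),
    K = PointedCone.hull ℝ (s : Set (EuclideanSpace ℝ (Fin n)))

/-- The cone `K` contains a line (through the origin). -/
def ContainsLine {n : ℕ} (K : PointedCone ℝ (EuclideanSpace ℝ (Fin n))) : Prop :=
  ∃ u : EuclideanSpace ℝ (Fin n), u ≠ 0 ∧ ∀ t : ℝ, t • u ∈ K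

/-- The dimension of a cone, that is, the dimension of its linear span (a cone contains `0`, so
this is also its affine dimension). -/
noncomputable def coneDim {n : ℕ} (K : PointedCone ℝ (EuclideanSpace ℝ (Fin n))) : ℕ :=
  Module.finrank ℝ (Submodule.span ℝ (K : Set (EuclideanSpace ℝ (Fin n))))

/-- The indicator function `[K]` of a cone. -/
noncomputable def coneIndicator {n : ℕ} (K : PointedCone ℝ (EuclideanSpace ℝ (Fin n))) :
    EuclideanSpace ℝ (Fin n) → ℤ :=
  Set.indicator (K : Set (EuclideanSpace ℝ (Fin n))) 1

/-- The group generated by the indicator functions of polyhedral cones containing lines. -/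
def lineConeIndicators (n : ℕ) : AddSubgroup (EuclideanSpace ℝ (Fin n) → ℤ) :=
  AddSubgroup.closure
    {f | ∃ K : PointedCone ℝ (EuclideanSpace ℝ (Fin n)),
      IsPolyhedralCone K ∧ ContainsLine K ∧ f = coneIndicator K}

/-- The cone `C` is decomposed into the cones `K₁, …, K_N` with signs `s₁, …, s_N ∈ {±1}`:
`[C] ≡ ∑ sᵢ [Kᵢ]` modulo indicator functions of cones containing lines. -/
def IsDecomposition {n N : ℕ} (C : PointedCone ℝ (EuclideanSpace ℝ (Fin n)))
    (s : Fin N → ℤ) (K : Fin N → PointedCone ℝ (EuclideanSpace ℝ (Fin n))) : Prop :=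
  (∀ i, s i = 1 ∨ s i = -1) ∧
    coneIndicator C - ∑ i, s i • coneIndicator (K i) ∈ lineConeIndicators n

/-- The associated matrix `M_n` of the vectors `v₁, …, v_n`: ones on the diagonal and
`-|vᵢ · vⱼ|` off the diagonal. -/
noncomputable def assocMatrix {n : ℕ} (v : Fin n → EuclideanSpace ℝ (Fin n)) :
    Matrix (Fin n) (Fin n) ℝ :=
  Matrix.of fun i j => if i = j then 1 else -|inner ℝ (v i) (v j)|

/-- The properties (a)–(e) of vectors `v₁, …, v_n` relative to `w₁, …, w_n`. The entry with index
`i : Fin n` is the vector number `i + 1`. -/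
structure HasDecompProperties {n : ℕ} (w v : Fin n → EuclideanSpace ℝ (Fin n)) : Prop where
  /-- (a) every `vᵢ` is a unit vector -/
  norm_eq_one : ∀ i, ‖v i‖ = 1
  /-- (b) `v_n = w_n` -/
  last_eq : ∀ i : Fin n, (i : ℕ) + 1 = n → v i = w i
  /-- (c) `⟨v₁, …, v_{n-1}⟩ = ⟨w₁, …, w_{n-1}⟩` -/
  span_eq : Submodule.span ℝ (v '' {i | (i : ℕ) + 1 < n}) =
    Submodule.span ℝ (w '' {i | (i : ℕ) + 1 < n})
  /-- (d) `vᵢ · v_n = 0` for `1 ≤ i ≤ n - 2` -/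
  inner_last_eq_zero : ∀ i j : Fin n, (i : ℕ) + 2 < n → (j : ℕ) + 1 = n → inner ℝ (v i) (v j) = 0
  /-- (e) for suitable signs, `xᵀ M_n x = ‖[ε₁ v₁, …, ε_n v_n] x‖²` for all `x` -/
  quadratic_form : ∃ ε : Fin n → ℝ, (∀ i, ε i = 1 ∨ ε i = -1) ∧
    ∀ x : Fin n → ℝ, x ⬝ᵥ (assocMatrix v).mulVec x = ‖∑ i, x i • (ε i • v i)‖ ^ 2

/-!
Let `L` be a hyperplane of a subspace `K`. Modulo cones with lines in `K`, every simplicial cone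
in `K` is an integer combination of simplicial cones in `K` with exactly one generator off `L`
(`coneIndicator_mem_closure_oneOffCones`). Indeed, two generators `a`, `b` off `L` determine a
vector `c = b - r a` of `L`, and inclusion-exclusion in the plane of `a` and `b` writes the
indicator function through cones in which `c` or `-c` replaces one of them: for `r < 0` the vector
`c` subdivides the cone, for `r > 0` the cone is the intersection of two cones whose union contains
the line `ℝ c`. A cone inside `L` is handled by adding the rays through `x` and `-x`, with `x` off
`L`.

For a cone generated by a simplicial cone in `K` and a unit vector `x` off `K`, take `L` orthogonal
to `x`. After the first step the cone in `K` has a single generator `x'` off `L`, which may be taken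
to be a unit vector, and by induction on the dimension it is a combination of cones with last
generator `x'` whose other generators span `L`. Adding the ray through `x` preserves relations
between cones in `K` (`extendByRay`). In the resulting cones only `x'` can fail to be orthogonal to
`x`, which gives property (d), and the sign of `x` can be chosen so that the signed generators have
pairwise nonpositive inner products (`IsAdapted.snoc`). This recursion is
`coneIndicator_mem_closure_adaptedCones`; the theorem is the case in which `x` is the last of the
given vectors and `K` is the span of the others. With such signs the associated matrix is the Gram
matrix of the signed generators, so (e) and positive definiteness follow.
-/

/-! ### Cones spanned by one or two further generators -/

theorem mem_hull_insert {n : ℕ} {s : Set (EuclideanSpace ℝ (Fin n))}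
    {x y : EuclideanSpace ℝ (Fin n)} :
    y ∈ PointedCone.hull ℝ (insert x s) ↔ ∃ t : ℝ, 0 ≤ t ∧ y - t • x ∈ PointedCone.hull ℝ s := by
  rw [PointedCone.hull, Submodule.mem_span_insert]
  constructor
  · rintro ⟨a, z, hz, rfl⟩
    exact ⟨a, a.2, by rwa [show (a : ℝ) • x = a • x from rfl, add_sub_cancel_left]⟩
  · rintro ⟨t, ht, h⟩
    exact ⟨⟨t, ht⟩, _, h, by simp [Nonneg.mk_smul]⟩

theorem hull_le_of_subset {n : ℕ} {s : Set (EuclideanSpace ℝ (Fin n))}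
    {K : Submodule ℝ (EuclideanSpace ℝ (Fin n))} (hs : s ⊆ K) {y : EuclideanSpace ℝ (Fin n)}
    (hy : y ∈ PointedCone.hull ℝ s) : y ∈ K :=
  Submodule.span_le.2 hs (PointedCone.hull_le_span ℝ s hy)

theorem apply_eq_zero_of_mem_hull {n : ℕ} {s : Set (EuclideanSpace ℝ (Fin n))}
    {φ : EuclideanSpace ℝ (Fin n) →ₗ[ℝ] ℝ} (hs : ∀ z ∈ s, φ z = 0)
    {y : EuclideanSpace ℝ (Fin n)} (hy : y ∈ PointedCone.hull ℝ s) : φ y = 0 :=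
  LinearMap.mem_ker.1 (hull_le_of_subset (K := LinearMap.ker φ) hs hy)

theorem mem_hull_insert_iff_of_dual {n : ℕ} {s : Set (EuclideanSpace ℝ (Fin n))}
    {φ : EuclideanSpace ℝ (Fin n) →ₗ[ℝ] ℝ} (hs : ∀ z ∈ s, φ z = 0)
    {x : EuclideanSpace ℝ (Fin n)} (hx : φ x = 1) (y : EuclideanSpace ℝ (Fin n)) :
    y ∈ PointedCone.hull ℝ (insert x s) ↔
      0 ≤ φ y ∧ y - φ y • x ∈ PointedCone.hull ℝ s := by
  rw [mem_hull_insert]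
  constructor
  · rintro ⟨t, ht, h⟩
    have h0 := apply_eq_zero_of_mem_hull hs h
    simp only [map_sub, map_smul, hx, smul_eq_mul, mul_one] at h0
    obtain rfl : φ y = t := by linarith
    exact ⟨ht, h⟩
  · rintro ⟨ht, h⟩
    exact ⟨_, ht, h⟩

/-- Membership in a cone with two extra generators from the plane of `a` and `b`, read off in the
coordinates `α`, `β` dual to `a`, `b`. -/
theorem mem_hull_insert_insert_iff_of_dual {n : ℕ} {s : Set (EuclideanSpace ℝ (Fin n))}
    {α β : EuclideanSpace ℝ (Fin n) →ₗ[ℝ] ℝ} (hα : ∀ z ∈ s, α z = 0) (hβ : ∀ z ∈ s, β z = 0)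
    {a b : EuclideanSpace ℝ (Fin n)} (haa : α a = 1) (hab : α b = 0) (hba : β a = 0)
    (hbb : β b = 1) (p₁ p₂ q₁ q₂ : ℝ) (y : EuclideanSpace ℝ (Fin n)) :
    y ∈ PointedCone.hull ℝ (insert (p₁ • a + p₂ • b) (insert (q₁ • a + q₂ • b) s)) ↔
      (∃ t u : ℝ, 0 ≤ t ∧ 0 ≤ u ∧ α y = t * p₁ + u * q₁ ∧ β y = t * p₂ + u * q₂) ∧
        y - α y • a - β y • b ∈ PointedCone.hull ℝ s := by
  simp only [mem_hull_insert]
  constructor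
  · rintro ⟨t, ht, u, hu, h⟩
    have h1 := apply_eq_zero_of_mem_hull hα h
    have h2 := apply_eq_zero_of_mem_hull hβ h
    simp only [map_sub, map_add, map_smul, smul_eq_mul, haa, hab, hba, hbb] at h1 h2
    have h1' : α y = t * p₁ + u * q₁ := by linarith
    have h2' : β y = t * p₂ + u * q₂ := by linarith
    refine ⟨⟨t, u, ht, hu, h1', h2'⟩, ?_⟩
    convert h using 1
    rw [h1', h2']
    module
  · rintro ⟨⟨t, u, ht, hu, h1, h2⟩, h⟩
    refine ⟨t, ht, u, hu, ?_⟩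
    convert h using 1
    rw [h1, h2]
    module

theorem mem_hull_insert_insert_sub_iff {n : ℕ} {s : Set (EuclideanSpace ℝ (Fin n))}
    {α β : EuclideanSpace ℝ (Fin n) →ₗ[ℝ] ℝ} (hα : ∀ z ∈ s, α z = 0) (hβ : ∀ z ∈ s, β z = 0)
    {a b : EuclideanSpace ℝ (Fin n)} (haa : α a = 1) (hab : α b = 0) (hba : β a = 0)
    (hbb : β b = 1) (r : ℝ) (y : EuclideanSpace ℝ (Fin n)) :
    y ∈ PointedCone.hull ℝ (insert a (insert (b - r • a) s)) ↔
      (0 ≤ β y ∧ 0 ≤ α y + r * β y) ∧ y - α y • a - β y • b ∈ PointedCone.hull ℝ s := by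
  have := mem_hull_insert_insert_iff_of_dual hα hβ haa hab hba hbb 1 0 (-r) 1 y
  rw [show (1 : ℝ) • a + (0 : ℝ) • b = a by module,
    show (-r) • a + (1 : ℝ) • b = b - r • a by module] at this
  rw [this]
  refine and_congr_left fun _ =>
    ⟨?_, fun h => ⟨α y + r * β y, β y, h.2, h.1, by ring, by ring⟩⟩
  rintro ⟨t, u, ht, hu, h1, h2⟩
  rw [h1, h2]
  constructor <;> linarith

theorem max_zero_eq_add_max_neg (t : ℝ) : max t 0 = t + max (-t) 0 := by
  rcases le_total t 0 with h | h
  · rw [max_eq_right h, max_eq_left (by linarith)]; ring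
  · rw [max_eq_left h, max_eq_right (by linarith)]; ring

theorem coneIndicator_apply {n : ℕ} (K : PointedCone ℝ (EuclideanSpace ℝ (Fin n)))
    [DecidablePred (· ∈ K)] (y : EuclideanSpace ℝ (Fin n)) :
    coneIndicator K y = if y ∈ K then 1 else 0 := by
  simp [coneIndicator, Set.indicator_apply]

/-! ### Relations between indicator functions -/

section Relations

variable {n : ℕ} {s : Set (EuclideanSpace ℝ (Fin n))} {a b : EuclideanSpace ℝ (Fin n)} {r : ℝ}

/-- If the generators `a`, `b` lie on the same side of a hyperplane through `c = b - r • a`, the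
cone is the intersection of two cones whose union is a cone with the line `ℝ c`. -/
theorem coneIndicator_insert_insert_of_pos (hr : 0 < r)
    {α β : EuclideanSpace ℝ (Fin n) →ₗ[ℝ] ℝ} (hα : ∀ z ∈ s, α z = 0) (hβ : ∀ z ∈ s, β z = 0)
    (haa : α a = 1) (hab : α b = 0) (hba : β a = 0) (hbb : β b = 1) :
    coneIndicator (PointedCone.hull ℝ (insert a (insert b s))) =
      coneIndicator (PointedCone.hull ℝ (insert a (insert (b - r • a) s))) +
      coneIndicator (PointedCone.hull ℝ (insert b (insert (-(b - r • a)) s))) -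
      coneIndicator (PointedCone.hull ℝ
        (insert a (insert (b - r • a) (insert (-(b - r • a)) s)))) := by
  classical
  funext y
  have key := mem_hull_insert_insert_iff_of_dual hα hβ haa hab hba hbb
  have e2 := mem_hull_insert_insert_sub_iff hα hβ haa hab hba hbb r y
  have e1 := mem_hull_insert_insert_sub_iff hα hβ haa hab hba hbb 0 y
  simp only [zero_smul, sub_zero, zero_mul, add_zero] at e1
  have e3 : y ∈ PointedCone.hull ℝ (insert b (insert (-(b - r • a)) s)) ↔
      (0 ≤ α y ∧ 0 ≤ α y + r * β y) ∧ y - α y • a - β y • b ∈ PointedCone.hull ℝ s := by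
    have := key 0 1 r (-1) y
    rw [show (0 : ℝ) • a + (1 : ℝ) • b = b by module,
      show r • a + (-1 : ℝ) • b = -(b - r • a) by module] at this
    rw [this]
    refine and_congr_left fun _ => ⟨?_, fun h =>
      ⟨(α y + r * β y) / r, α y / r, by have := h.2; positivity, by have := h.1; positivity,
        by field_simp; ring, by field_simp; ring⟩⟩
    rintro ⟨t, u, ht, hu, h1, h2⟩
    have h3 : 0 ≤ u * r := by positivity
    have h4 : 0 ≤ r * t := by positivity
    rw [h1, h2]
    constructor <;> linarith
  have e4 : y ∈ PointedCone.hull ℝ (insert a (insert (b - r • a) (insert (-(b - r • a)) s))) ↔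
      0 ≤ α y + r * β y ∧ y - α y • a - β y • b ∈ PointedCone.hull ℝ s := by
    simp only [mem_hull_insert]
    constructor
    · rintro ⟨t, ht, u, hu, v, hv, h⟩
      have h1 := apply_eq_zero_of_mem_hull hα h
      have h2 := apply_eq_zero_of_mem_hull hβ h
      simp only [map_sub, map_neg, map_smul, smul_eq_mul, haa, hab, hba, hbb] at h1 h2
      have h1' : α y = t - (u - v) * r := by linarith
      have h2' : β y = u - v := by linarith
      refine ⟨by rw [h1', h2']; linarith, ?_⟩
      convert h using 1
      rw [h1', h2']
      module
    · rintro ⟨h1, h⟩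
      refine ⟨_, h1, max (β y) 0, le_max_right _ _, max (-β y) 0, le_max_right _ _, ?_⟩
      convert h using 1
      rw [max_zero_eq_add_max_neg]
      module
  simp only [Pi.add_apply, Pi.sub_apply, coneIndicator_apply, e1, e2, e3, e4]
  by_cases h : y - α y • a - β y • b ∈ PointedCone.hull ℝ s
  · simp only [h, and_true]
    by_cases h1 : 0 ≤ α y <;> by_cases h2 : 0 ≤ β y <;> by_cases h3 : 0 ≤ α y + r * β y <;>
      simp only [h1, h2, h3] <;> simp
    · nlinarith
    · nlinarith
  · simp [h]

/-- If the generators `a`, `b` lie on opposite sides of a hyperplane through `c = b - r • a`, the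
vector `c` subdivides the cone. -/
theorem coneIndicator_insert_insert_of_neg (hr : r < 0)
    {α β : EuclideanSpace ℝ (Fin n) →ₗ[ℝ] ℝ} (hα : ∀ z ∈ s, α z = 0) (hβ : ∀ z ∈ s, β z = 0)
    (haa : α a = 1) (hab : α b = 0) (hba : β a = 0) (hbb : β b = 1) :
    coneIndicator (PointedCone.hull ℝ (insert a (insert b s))) =
      coneIndicator (PointedCone.hull ℝ (insert a (insert (b - r • a) s))) +
      coneIndicator (PointedCone.hull ℝ (insert b (insert (b - r • a) s))) -
      coneIndicator (PointedCone.hull ℝ (insert (b - r • a) s)) := by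
  classical
  funext y
  have key := mem_hull_insert_insert_iff_of_dual hα hβ haa hab hba hbb
  have e2 := mem_hull_insert_insert_sub_iff hα hβ haa hab hba hbb r y
  have e1 := mem_hull_insert_insert_sub_iff hα hβ haa hab hba hbb 0 y
  simp only [zero_smul, sub_zero, zero_mul, add_zero] at e1
  have e3 : y ∈ PointedCone.hull ℝ (insert b (insert (b - r • a) s)) ↔
      (0 ≤ α y ∧ α y + r * β y ≤ 0) ∧ y - α y • a - β y • b ∈ PointedCone.hull ℝ s := by
    have := key 0 1 (-r) 1 y
    rw [show (0 : ℝ) • a + (1 : ℝ) • b = b by module,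
      show (-r) • a + (1 : ℝ) • b = b - r • a by module] at this
    rw [this]
    have hr0 : r ≠ 0 := hr.ne
    refine and_congr_left fun _ => ⟨?_, fun h =>
      ⟨(α y + r * β y) / r, -α y / r, div_nonneg_of_nonpos h.2 hr.le,
        div_nonneg_of_nonpos (by linarith [h.1]) hr.le,
        by field_simp; ring, by field_simp; ring⟩⟩
    rintro ⟨t, u, ht, hu, h1, h2⟩
    rw [h1, h2]
    constructor <;> nlinarith
  have e4 : y ∈ PointedCone.hull ℝ (insert (b - r • a) s) ↔
      (0 ≤ β y ∧ α y + r * β y = 0) ∧ y - α y • a - β y • b ∈ PointedCone.hull ℝ s := by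
    rw [mem_hull_insert]
    constructor
    · rintro ⟨t, ht, h⟩
      have h1 := apply_eq_zero_of_mem_hull hα h
      have h2 := apply_eq_zero_of_mem_hull hβ h
      simp only [map_sub, map_smul, smul_eq_mul, haa, hab, hba, hbb] at h1 h2
      have h1' : α y = - t * r := by linarith
      have h2' : β y = t := by linarith
      refine ⟨⟨by linarith, by rw [h1', h2']; ring⟩, ?_⟩
      convert h using 1
      rw [h1', h2']
      module
    · rintro ⟨⟨h1, h2⟩, h⟩
      refine ⟨_, h1, ?_⟩
      convert h using 1
      rw [show α y = - (r * β y) by linarith]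
      module
  simp only [Pi.add_apply, Pi.sub_apply, coneIndicator_apply, e1, e2, e3, e4]
  by_cases h : y - α y • a - β y • b ∈ PointedCone.hull ℝ s
  · simp only [h, and_true]
    rcases lt_trichotomy (α y + r * β y) 0 with h3 | h3 | h3
    · by_cases h1 : 0 ≤ α y
      · have h2 : 0 ≤ β y := by nlinarith
        simp [h1, h2, h3.not_ge, h3.le, h3.ne]
      · simp [h1, h3.not_ge, h3.ne]
    · by_cases h1 : 0 ≤ α y
      · have h2 : 0 ≤ β y := by nlinarith
        simp [h1, h2, h3]
      · have h2 : ¬ 0 ≤ β y := fun h2 => h1 (by nlinarith)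
        simp [h1, h2]
    · by_cases h2 : 0 ≤ β y
      · have h1 : 0 ≤ α y := by nlinarith
        simp [h1, h2, h3.not_ge, h3.le, h3.ne']
      · simp [h2, h3.not_ge]
  · simp [h]

/-- A ray `ℝ≥0 x` off the span of a cone, its negative and the line `ℝ x` express the cone through
cones of one dimension more, up to a cone with a line. -/
theorem coneIndicator_eq_add_sub {φ : EuclideanSpace ℝ (Fin n) →ₗ[ℝ] ℝ}
    (hs : ∀ z ∈ s, φ z = 0) {x : EuclideanSpace ℝ (Fin n)} (hx : φ x = 1) :
    coneIndicator (PointedCone.hull ℝ s) =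
      coneIndicator (PointedCone.hull ℝ (insert x s)) +
      coneIndicator (PointedCone.hull ℝ (insert (-x) s)) -
      coneIndicator (PointedCone.hull ℝ (insert x (insert (-x) s))) := by
  classical
  funext y
  have e0 : y ∈ PointedCone.hull ℝ s ↔ φ y = 0 ∧ y - φ y • x ∈ PointedCone.hull ℝ s := by
    constructor
    · intro h
      have := apply_eq_zero_of_mem_hull hs h
      simpa [this] using h
    · rintro ⟨h1, h2⟩
      simpa [h1] using h2
  have e1 := mem_hull_insert_iff_of_dual hs hx y
  have e2 := mem_hull_insert_iff_of_dual (φ := -φ) (s := s) (x := -x)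
    (by simpa using hs) (by simpa using hx) y
  simp only [LinearMap.neg_apply, neg_smul_neg] at e2
  have e3 : y ∈ PointedCone.hull ℝ (insert x (insert (-x) s)) ↔
      y - φ y • x ∈ PointedCone.hull ℝ s := by
    rw [mem_hull_insert]
    simp only [mem_hull_insert]
    constructor
    · rintro ⟨t, ht, u, hu, h⟩
      have h1 := apply_eq_zero_of_mem_hull hs h
      simp only [map_sub, map_neg, map_smul, smul_eq_mul, hx] at h1
      convert h using 1
      rw [show φ y = t - u by linarith]
      module
    · intro h
      refine ⟨max (φ y) 0, le_max_right _ _, max (-φ y) 0, le_max_right _ _, ?_⟩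
      convert h using 1
      rw [max_zero_eq_add_max_neg]
      module
  simp only [Pi.add_apply, Pi.sub_apply, coneIndicator_apply]
  rw [if_congr e0 rfl rfl]
  simp only [e1, e2, e3]
  by_cases h : y - φ y • x ∈ PointedCone.hull ℝ s
  · simp only [h, and_true, Left.nonneg_neg_iff]
    rcases lt_trichotomy (φ y) 0 with h3 | h3 | h3
    · simp [h3.ne, h3.not_ge, h3.le]
    · simp [h3]
    · simp [h3.ne', h3.not_ge, h3.le]
  · simp [h]

end Relations

/-! ### Linear functionals and linear independence -/

theorem exists_dual_eq_one {n : ℕ} {K : Submodule ℝ (EuclideanSpace ℝ (Fin n))}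
    {x : EuclideanSpace ℝ (Fin n)} (hx : x ∉ K) :
    ∃ φ : EuclideanSpace ℝ (Fin n) →ₗ[ℝ] ℝ, (∀ z ∈ K, φ z = 0) ∧ φ x = 1 := by
  obtain ⟨φ, hφ, hK⟩ := Submodule.exists_le_ker_of_notMem hx
  refine ⟨(φ x)⁻¹ • φ, fun z hz => ?_, ?_⟩
  · simp [LinearMap.mem_ker.1 (hK hz)]
  · simp [hφ]

theorem linearIndepOn_insert_of_dual {n : ℕ} {s : Set (EuclideanSpace ℝ (Fin n))}
    {x : EuclideanSpace ℝ (Fin n)} (hs : LinearIndepOn ℝ id s)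
    (φ : EuclideanSpace ℝ (Fin n) →ₗ[ℝ] ℝ) (hφ : ∀ z ∈ s, φ z = 0) (hx : φ x ≠ 0) :
    LinearIndepOn ℝ id (insert x s) := by
  refine hs.id_insert fun h => hx ?_
  have : Submodule.span ℝ s ≤ LinearMap.ker φ := Submodule.span_le.2 hφ
  exact LinearMap.mem_ker.1 (this h)

theorem finite_of_linearIndepOn {n : ℕ} {s : Set (EuclideanSpace ℝ (Fin n))}
    (hs : LinearIndepOn ℝ id s) : s.Finite :=
  LinearIndependent.setFinite hs

theorem isPolyhedralCone_hull {n : ℕ} {s : Set (EuclideanSpace ℝ (Fin n))} (hs : s.Finite) :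
    IsPolyhedralCone (PointedCone.hull ℝ s) :=
  ⟨hs.toFinset, by simp⟩

theorem containsLine_hull {n : ℕ} {s : Set (EuclideanSpace ℝ (Fin n))}
    {u : EuclideanSpace ℝ (Fin n)} (hu : u ≠ 0) (h1 : u ∈ s) (h2 : -u ∈ s) :
    ContainsLine (PointedCone.hull ℝ s) := by
  refine ⟨u, hu, fun t => ?_⟩
  rcases le_total 0 t with ht | ht
  · exact PointedCone.smul_mem _ ht (PointedCone.subset_hull h1)
  · have := PointedCone.smul_mem (PointedCone.hull ℝ s) (neg_nonneg.2 ht)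
      (PointedCone.subset_hull h2)
    rwa [neg_smul_neg] at this

theorem hull_insert_smul {n : ℕ} {s : Set (EuclideanSpace ℝ (Fin n))}
    {x : EuclideanSpace ℝ (Fin n)} {c : ℝ} (hc : 0 < c) :
    PointedCone.hull ℝ (insert (c • x) s) = PointedCone.hull ℝ (insert x s) := by
  ext y
  rw [mem_hull_insert, mem_hull_insert]
  constructor
  · rintro ⟨t, ht, h⟩
    exact ⟨t * c, by positivity, by rwa [mul_smul]⟩
  · rintro ⟨t, ht, h⟩
    refine ⟨t / c, by positivity, ?_⟩
    rwa [smul_smul, div_mul_cancel₀ _ hc.ne']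

/-! ### Moving all but one generator into a hyperplane -/

/-- The indicator functions of the polyhedral cones inside `H` that contain a line. -/
def lineConesIn {n : ℕ} (H : Submodule ℝ (EuclideanSpace ℝ (Fin n))) :
    Set (EuclideanSpace ℝ (Fin n) → ℤ) :=
  {f | ∃ s : Set (EuclideanSpace ℝ (Fin n)), s.Finite ∧ s ⊆ H ∧
    ContainsLine (PointedCone.hull ℝ s) ∧ f = coneIndicator (PointedCone.hull ℝ s)}

/-- The indicator functions of the simplicial cones inside `H` all of whose generators except one
unit vector lie in `K`. -/
def oneOffCones {n : ℕ} (H K : Submodule ℝ (EuclideanSpace ℝ (Fin n))) :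
    Set (EuclideanSpace ℝ (Fin n) → ℤ) :=
  {f | ∃ x ∈ H, x ∉ K ∧ ‖x‖ = 1 ∧ ∃ A : Set (EuclideanSpace ℝ (Fin n)), A ⊆ K ∧
    LinearIndepOn ℝ id A ∧ f = coneIndicator (PointedCone.hull ℝ (insert x A))}

theorem coneIndicator_insert_mem_oneOffCones {n : ℕ}
    {H K : Submodule ℝ (EuclideanSpace ℝ (Fin n))} {x : EuclideanSpace ℝ (Fin n)} (hxH : x ∈ H)
    (hxK : x ∉ K) {A : Set (EuclideanSpace ℝ (Fin n))} (hA : A ⊆ K) (hA' : LinearIndepOn ℝ id A) :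
    coneIndicator (PointedCone.hull ℝ (insert x A)) ∈ oneOffCones H K := by
  have hx0 : x ≠ 0 := fun h => hxK (h ▸ K.zero_mem)
  have hpos : 0 < ‖x‖⁻¹ := inv_pos.2 (norm_pos_iff.2 hx0)
  refine ⟨‖x‖⁻¹ • x, H.smul_mem _ hxH, fun h => hxK ((K.smul_mem_iff hpos.ne').1 h),
    norm_smul_inv_norm (𝕜 := ℝ) hx0, A, hA, hA', ?_⟩
  rw [hull_insert_smul hpos]

/-- Modulo cones with lines, a simplicial cone in `H` is a combination of simplicial cones with
exactly one generator off the hyperplane `K` of `H`: the relations for a pair of generators off `K`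
replace one of them by a vector of `K`. -/
theorem coneIndicator_mem_closure_oneOffCones {n : ℕ}
    {H K : Submodule ℝ (EuclideanSpace ℝ (Fin n))} (hKH : K ≤ H)
    (hcodim : ∀ a ∈ H, a ∉ K → ∀ b ∈ H, ∃ r : ℝ, b - r • a ∈ K)
    {x : EuclideanSpace ℝ (Fin n)} (hxH : x ∈ H) (hxK : x ∉ K)
    {s : Set (EuclideanSpace ℝ (Fin n))} (hsH : s ⊆ H) (hs : LinearIndepOn ℝ id s) :
    coneIndicator (PointedCone.hull ℝ s) ∈
      AddSubgroup.closure (lineConesIn H ∪ oneOffCones H K) := by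
  obtain ⟨m, hm⟩ : ∃ m, (s \ K).ncard ≤ m := ⟨_, le_rfl⟩
  induction m generalizing s with
  | zero =>
    have hfin := finite_of_linearIndepOn hs
    have hsK : s ⊆ K := by
      rw [Nat.le_zero, Set.ncard_eq_zero hfin.sdiff] at hm
      exact Set.sdiff_eq_empty.1 hm
    obtain ⟨φ, hφ, hφx⟩ := exists_dual_eq_one hxK
    rw [coneIndicator_eq_add_sub (fun z hz => hφ z (hsK hz)) hφx]
    refine sub_mem (add_mem ?_ ?_) ?_
    · exact AddSubgroup.subset_closure
        (Or.inr (coneIndicator_insert_mem_oneOffCones hxH hxK hsK hs))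
    · exact AddSubgroup.subset_closure (Or.inr (coneIndicator_insert_mem_oneOffCones
        (H.neg_mem hxH) (by simpa using hxK) hsK hs))
    · refine AddSubgroup.subset_closure (Or.inl ⟨_, (hfin.insert _).insert _, ?_,
        containsLine_hull (u := x) (fun h => hxK (h ▸ K.zero_mem)) (by simp) (by simp), rfl⟩)
      simp only [Set.insert_subset_iff]
      exact ⟨hxH, H.neg_mem hxH, hsH⟩
  | succ m ih =>
    by_cases hsub : (s \ K).Subsingleton
    · by_cases hm0 : (s \ K).ncard ≤ m
      · exact ih hsH hs hm0
      obtain ⟨a, ha⟩ : (s \ K).Nonempty := by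
        rw [Set.nonempty_iff_ne_empty]
        intro h
        simp [h] at hm0
      have hsplit : s = insert a (s ∩ K) := by
        ext z
        simp only [Set.mem_insert_iff, Set.mem_inter_iff]
        constructor
        · intro hz
          by_cases hzK : z ∈ K
          · exact Or.inr ⟨hz, hzK⟩
          · exact Or.inl (hsub ⟨hz, hzK⟩ ha)
        · rintro (rfl | h)
          exacts [ha.1, h.1]
      rw [hsplit]
      exact AddSubgroup.subset_closure (Or.inr (coneIndicator_insert_mem_oneOffCones
        (hsH ha.1) ha.2 Set.inter_subset_right (hs.mono Set.inter_subset_left)))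
    · obtain ⟨a, ha, b, hb, hab⟩ := Set.not_subsingleton_iff.1 hsub
      set T : Set (EuclideanSpace ℝ (Fin n)) := s \ {a, b} with hT
      have hTs : T ⊆ s := Set.sdiff_subset
      have haT : a ∉ T := fun h => h.2 (by simp)
      have hbT : b ∉ T := fun h => h.2 (by simp)
      have hsplit : s = insert a (insert b T) := by
        ext z
        simp only [hT, Set.mem_insert_iff, Set.mem_sdiff, Set.mem_singleton_iff]
        have h1 := ha.1
        have h2 := hb.1
        constructor
        · tauto
        · rintro (rfl | rfl | h)
          exacts [h1, h2, h.1]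
      have hTI : LinearIndepOn ℝ id T := hs.mono hTs
      have hTfin := finite_of_linearIndepOn hTI
      have haspan : a ∉ Submodule.span ℝ (insert b T) :=
        ((linearIndepOn_id_insert (by simp [hab, haT])).1 (hsplit ▸ hs)).2
      have hbspan : b ∉ Submodule.span ℝ (insert a T) := by
        have h : LinearIndepOn ℝ id (insert b (insert a T)) := by
          rw [Set.insert_comm, ← hsplit]
          exact hs
        exact ((linearIndepOn_id_insert (by simp [hab.symm, hbT])).1 h).2
      obtain ⟨α, hα, haa⟩ := exists_dual_eq_one haspan
      obtain ⟨β, hβ, hbb⟩ := exists_dual_eq_one hbspan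
      have hab0 : α b = 0 := hα b (Submodule.subset_span (by simp))
      have hba0 : β a = 0 := hβ a (Submodule.subset_span (by simp))
      have hαT : ∀ z ∈ T, α z = 0 := fun z hz => hα z (Submodule.subset_span (by simp [hz]))
      have hβT : ∀ z ∈ T, β z = 0 := fun z hz => hβ z (Submodule.subset_span (by simp [hz]))
      have haH := hsH ha.1
      have hbH := hsH hb.1
      have hTH := hTs.trans hsH
      obtain ⟨r, hr⟩ := hcodim a haH ha.2 b hbH
      have hr0 : r ≠ 0 := by
        rintro rfl
        exact hb.2 (by simpa using hr)
      have hcH := hKH hr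
      have hcI : ∀ e : ℝ, e ≠ 0 → LinearIndepOn ℝ id (insert (e • (b - r • a)) T) := fun e he =>
        linearIndepOn_insert_of_dual hTI β hβT (by simp [hbb, hba0, he])
      -- the functional `α + r β` vanishes at `b - r • a` but neither at `a` nor at `b`
      have hker : ∀ e : ℝ, ∀ z ∈ insert (e • (b - r • a)) T, (α + r • β) z = 0 := by
        rintro e z (rfl | hz)
        · simp [haa, hbb, hab0, hba0]
        · simp [hαT z hz, hβT z hz]
      have haI : ∀ e : ℝ, e ≠ 0 →
          LinearIndepOn ℝ id (insert a (insert (e • (b - r • a)) T)) := fun e he =>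
        linearIndepOn_insert_of_dual (hcI e he) (α + r • β) (hker e) (by simp [haa, hba0])
      have hbI : ∀ e : ℝ, e ≠ 0 →
          LinearIndepOn ℝ id (insert b (insert (e • (b - r • a)) T)) := fun e he =>
        linearIndepOn_insert_of_dual (hcI e he) (α + r • β) (hker e) (by simp [hbb, hab0, hr0])
      have hcard_s : (T \ K).ncard + 2 ≤ m + 1 := by
        have h1 : s \ K = insert a (insert b (T \ K)) := by
          conv_lhs => rw [hsplit]
          rw [Set.insert_sdiff_of_notMem _ ha.2, Set.insert_sdiff_of_notMem _ hb.2]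
        rw [h1, Set.ncard_insert_of_notMem (by simp [hab, haT]) (hTfin.sdiff.insert _),
          Set.ncard_insert_of_notMem (by simp [hbT]) hTfin.sdiff] at hm
        omega
      have hcard : ∀ p c : EuclideanSpace ℝ (Fin n), c ∈ K →
          (insert p (insert c T) \ K).ncard ≤ m := by
        intro p c hc
        have h1 : insert p (insert c T) \ (K : Set (EuclideanSpace ℝ (Fin n))) ⊆
            insert p (T \ K) := by
          rintro z ⟨rfl | rfl | hz, hzK⟩
          · simp
          · exact absurd hc hzK
          · exact Or.inr ⟨hz, hzK⟩
        have h2 := Set.ncard_le_ncard h1 (hTfin.sdiff.insert _)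
        have h3 := Set.ncard_insert_le p (T \ (K : Set (EuclideanSpace ℝ (Fin n))))
        omega
      have hcard' : ∀ c : EuclideanSpace ℝ (Fin n), c ∈ K → (insert c T \ K).ncard ≤ m := by
        intro c hc
        have := hcard c c hc
        rwa [Set.insert_eq_of_mem (Set.mem_insert _ _)] at this
      have hsubH : ∀ p c : EuclideanSpace ℝ (Fin n), p ∈ H → c ∈ H →
          insert p (insert c T) ⊆ (H : Set (EuclideanSpace ℝ (Fin n))) := fun p c hp hc =>
        Set.insert_subset hp (Set.insert_subset hc hTH)
      have one := one_ne_zero (α := ℝ)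
      have negone : (-1 : ℝ) ≠ 0 := by norm_num
      rw [hsplit]
      rcases hr0.lt_or_gt with hneg | hpos
      · rw [coneIndicator_insert_insert_of_neg hneg hαT hβT haa hab0 hba0 hbb]
        refine sub_mem (add_mem ?_ ?_) ?_
        · exact ih (hsubH _ _ haH hcH) (by simpa using haI 1 one) (hcard _ _ hr)
        · exact ih (hsubH _ _ hbH hcH) (by simpa using hbI 1 one) (hcard _ _ hr)
        · exact ih (Set.insert_subset hcH hTH) (by simpa using hcI 1 one) (hcard' _ hr)
      · rw [coneIndicator_insert_insert_of_pos hpos hαT hβT haa hab0 hba0 hbb]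
        refine sub_mem (add_mem ?_ ?_) ?_
        · exact ih (hsubH _ _ haH hcH) (by simpa using haI 1 one) (hcard _ _ hr)
        · exact ih (hsubH _ _ hbH (H.neg_mem hcH))
            (by simpa only [neg_one_smul] using hbI (-1) negone) (hcard _ _ (K.neg_mem hr))
        · refine AddSubgroup.subset_closure (Or.inl ⟨_, ((hTfin.insert _).insert _).insert _, ?_,
            containsLine_hull (u := b - r • a) (fun h => ?_) (by simp) (by simp), rfl⟩)
          · exact Set.insert_subset haH (hsubH _ _ hcH (H.neg_mem hcH))
          · have := congrArg β h
            simp [hbb, hba0] at this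

/-! ### Adding a fixed ray to a combination of cones -/

/-- The additive operator on functions that sends the indicator function of a cone `C` inside
`ker φ` to that of `C + ℝ≥0 x`, provided that `φ x = 1`. -/
noncomputable def extendByRay {n : ℕ} (φ : EuclideanSpace ℝ (Fin n) →ₗ[ℝ] ℝ)
    (x : EuclideanSpace ℝ (Fin n)) :
    (EuclideanSpace ℝ (Fin n) → ℤ) →+ (EuclideanSpace ℝ (Fin n) → ℤ) where
  toFun g y := if 0 ≤ φ y then g (y - φ y • x) else 0
  map_zero' := by ext; simp
  map_add' f g := by
    ext y
    by_cases h : 0 ≤ φ y <;> simp [h]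

theorem extendByRay_coneIndicator {n : ℕ} {s : Set (EuclideanSpace ℝ (Fin n))}
    {φ : EuclideanSpace ℝ (Fin n) →ₗ[ℝ] ℝ} (hs : ∀ z ∈ s, φ z = 0)
    {x : EuclideanSpace ℝ (Fin n)} (hx : φ x = 1) :
    extendByRay φ x (coneIndicator (PointedCone.hull ℝ s)) =
      coneIndicator (PointedCone.hull ℝ (insert x s)) := by
  classical
  funext y
  simp only [extendByRay, AddMonoidHom.coe_mk, ZeroHom.coe_mk, coneIndicator_apply,
    mem_hull_insert_iff_of_dual hs hx y, ite_and]

theorem range_eq_insert_last {α : Type*} {d : ℕ} (v : Fin (d + 1) → α) :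
    Set.range v = insert (v (Fin.last d)) (Set.range fun i : Fin d => v i.castSucc) := by
  rw [← Fin.range_snoc]
  congr 1
  exact (Fin.snoc_init_self v).symm

theorem genCone_eq_hull_insert {n d : ℕ} (v : Fin (d + 1) → EuclideanSpace ℝ (Fin n)) :
    genCone v = PointedCone.hull ℝ (insert (v (Fin.last d)) (Set.range fun i : Fin d =>
      v i.castSucc)) := by
  rw [genCone, range_eq_insert_last]

/-! ### The recursion on the dimension -/

/-- The target shape of the recursion, for `d + 1` unit vectors of `ℝⁿ`: the last vector is the
prescribed `x`, the others span the prescribed `K`, all of these except possibly the last one are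
orthogonal to `x`, and for a choice of signs the signed vectors have pairwise nonpositive inner
products. -/
structure IsAdapted {n d : ℕ} (K : Submodule ℝ (EuclideanSpace ℝ (Fin n)))
    (x : EuclideanSpace ℝ (Fin n)) (v : Fin (d + 1) → EuclideanSpace ℝ (Fin n)) : Prop where
  norm_eq_one : ∀ i, ‖v i‖ = 1
  last_eq : v (Fin.last d) = x
  span_eq : Submodule.span ℝ (Set.range fun i : Fin d => v i.castSucc) = K
  inner_eq_zero : ∀ i : Fin d, (i : ℕ) + 1 < d → inner ℝ (v i.castSucc) x = 0
  exists_signs : ∃ ε : Fin (d + 1) → ℝ, (∀ i, ε i = 1 ∨ ε i = -1) ∧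
    ∀ i j, i ≠ j → ε i * ε j * inner ℝ (v i) (v j) ≤ 0

/-- Among the vectors of `v` only the last, `x'`, can have a nonzero inner product with `x`, so the
sign of `x` can be chosen to keep all the signed inner products nonpositive. -/
theorem IsAdapted.snoc {n d : ℕ} {K L : Submodule ℝ (EuclideanSpace ℝ (Fin n))}
    {x' x : EuclideanSpace ℝ (Fin n)} {v : Fin (d + 1) → EuclideanSpace ℝ (Fin n)}
    (hv : IsAdapted L x' v) (hK : Submodule.span ℝ {x'} ⊔ L = K) (hL : ∀ z ∈ L, inner ℝ z x = 0)
    (hx : ‖x‖ = 1) :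
    IsAdapted K x (Fin.snoc v x : Fin (d + 1 + 1) → EuclideanSpace ℝ (Fin n)) := by
  have horth : ∀ i : Fin d, inner ℝ (v i.castSucc) x = 0 := fun i =>
    hL _ (hv.span_eq ▸ Submodule.subset_span ⟨i, rfl⟩)
  refine ⟨fun i => ?_, by simp, ?_, fun i hi => ?_, ?_⟩
  · induction i using Fin.lastCases with
    | last => simpa using hx
    | cast i => simpa using hv.norm_eq_one i
  · simp only [Fin.snoc_castSucc]
    rw [range_eq_insert_last v, hv.last_eq, Submodule.span_insert, hv.span_eq, hK]
  · have := horth ⟨i, by omega⟩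
    simpa using this
  · obtain ⟨ε, hε, hsign⟩ := hv.exists_signs
    obtain ⟨e, he, hlast⟩ : ∃ e : ℝ, (e = 1 ∨ e = -1) ∧
        ∀ i, ε i * e * inner ℝ (v i) x ≤ 0 := by
      have hcast : ∀ (e : ℝ) (i : Fin d), ε i.castSucc * e * inner ℝ (v i.castSucc) x ≤ 0 :=
        fun e i => by simp [horth i]
      rcases le_total (ε (Fin.last d) * inner ℝ (v (Fin.last d)) x) 0 with h | h
      · refine ⟨1, Or.inl rfl, fun i => ?_⟩
        induction i using Fin.lastCases with
        | last => linarith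
        | cast i => exact hcast _ i
      · refine ⟨-1, Or.inr rfl, fun i => ?_⟩
        induction i using Fin.lastCases with
        | last => linarith
        | cast i => exact hcast _ i
    refine ⟨Fin.snoc ε e, fun i => ?_, fun i j hij => ?_⟩
    · induction i using Fin.lastCases with
      | last => simpa using he
      | cast i => simpa using hε i
    · induction i using Fin.lastCases with
      | last =>
        induction j using Fin.lastCases with
        | last => exact absurd rfl hij
        | cast j =>
          have := hlast j
          rw [real_inner_comm] at this
          simp only [Fin.snoc_last, Fin.snoc_castSucc]
          linarith
      | cast i =>
        induction j using Fin.lastCases with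
        | last => simpa using hlast i
        | cast j => simpa using hsign i j (fun h => hij (congrArg _ h))

/-- The indicator functions of the cones generated by sequences adapted to `K` and `x`. -/
def adaptedCones {n : ℕ} (d : ℕ) (K : Submodule ℝ (EuclideanSpace ℝ (Fin n)))
    (x : EuclideanSpace ℝ (Fin n)) : Set (EuclideanSpace ℝ (Fin n) → ℤ) :=
  {f | ∃ v : Fin (d + 1) → EuclideanSpace ℝ (Fin n), IsAdapted K x v ∧
    f = coneIndicator (genCone v)}

/-- Every nonzero subspace `K` has a hyperplane orthogonal to `x`, here given as the kernel of a
functional on `K`: it is `K ∩ xᗮ` unless `K` itself is orthogonal to `x`. -/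
theorem exists_dual_ker_orthogonal {n : ℕ} {K : Submodule ℝ (EuclideanSpace ℝ (Fin n))}
    (hK : K ≠ ⊥) (x : EuclideanSpace ℝ (Fin n)) :
    ∃ ψ : EuclideanSpace ℝ (Fin n) →ₗ[ℝ] ℝ, (∃ k ∈ K, ψ k ≠ 0) ∧
      ∀ z ∈ K, ψ z = 0 → inner ℝ z x = 0 := by
  by_cases h : ∀ k ∈ K, inner ℝ k x = 0
  · obtain ⟨k, hk, hk0⟩ := K.exists_mem_ne_zero_of_ne_bot hK
    obtain ⟨ψ, -, hψ⟩ := exists_dual_eq_one (K := ⊥) (x := k) (by simpa using hk0)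
    exact ⟨ψ, ⟨k, hk, by simp [hψ]⟩, fun z hz _ => h z hz⟩
  · push Not at h
    obtain ⟨k, hk, hkx⟩ := h
    refine ⟨innerₗ _ x, ⟨k, hk, ?_⟩, fun z _ hz => ?_⟩
    · rwa [innerₗ_apply_apply, real_inner_comm]
    · rwa [innerₗ_apply_apply, real_inner_comm] at hz

theorem finrank_inf_ker_add_one {n : ℕ} {K : Submodule ℝ (EuclideanSpace ℝ (Fin n))}
    {ψ : EuclideanSpace ℝ (Fin n) →ₗ[ℝ] ℝ} (h : ∃ k ∈ K, ψ k ≠ 0) :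
    Module.finrank ℝ (K ⊓ LinearMap.ker ψ : Submodule ℝ (EuclideanSpace ℝ (Fin n))) + 1 =
      Module.finrank ℝ K := by
  obtain ⟨k, hk, hψ⟩ := h
  have h0 : (ψ.domRestrict K : Module.Dual ℝ K) ≠ 0 := fun h =>
    hψ (by simpa using LinearMap.congr_fun h ⟨k, hk⟩)
  rw [← Module.Dual.finrank_ker_add_one_of_ne_zero h0, LinearMap.ker_domRestrict,
    ← Submodule.map_comap_subtype, Submodule.finrank_map_subtype_eq]

/-- The main recursion. The hyperplane `L` of `K` is chosen orthogonal to `x`; a cone in `K` is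
rewritten so that only one generator `x'` is off `L`, the induction hypothesis applies to `L` and
`x'`, and `extendByRay` carries the resulting relation in `K` over to the cones with `x` added. -/
theorem coneIndicator_mem_closure_adaptedCones {n : ℕ} (d : ℕ)
    {K : Submodule ℝ (EuclideanSpace ℝ (Fin n))} {x : EuclideanSpace ℝ (Fin n)}
    (hd : Module.finrank ℝ K = d) (hx : ‖x‖ = 1) (hxK : x ∉ K)
    {s : Set (EuclideanSpace ℝ (Fin n))} (hsK : s ⊆ K) (hs : LinearIndepOn ℝ id s) :
    coneIndicator (PointedCone.hull ℝ (insert x s)) ∈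
      AddSubgroup.closure (lineConesIn (Submodule.span ℝ {x} ⊔ K) ∪ adaptedCones d K x) := by
  induction d generalizing K x s with
  | zero =>
    have hK : K = ⊥ := Submodule.finrank_eq_zero.1 hd
    have hs0 : s = ∅ := by
      refine Set.eq_empty_of_forall_notMem fun z hz => ?_
      have h1 : z = 0 := by simpa [hK] using hsK hz
      exact hs.ne_zero hz h1
    refine AddSubgroup.subset_closure (Or.inr ⟨fun _ => x, ⟨fun _ => hx, rfl, ?_, ?_,
      fun _ => 1, fun _ => Or.inl rfl, fun i j hij => ?_⟩, ?_⟩)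
    · simp [hK]
    · exact fun i => i.elim0
    · exact absurd (Fin.ext (by omega)) hij
    · rw [genCone_eq_hull_insert, hs0]
      simp
  | succ d ih =>
    have hK : K ≠ ⊥ := by
      rintro rfl
      simp at hd
    obtain ⟨ψ, hψ, hψx⟩ := exists_dual_ker_orthogonal hK x
    set L : Submodule ℝ (EuclideanSpace ℝ (Fin n)) := K ⊓ LinearMap.ker ψ with hL
    have hLK : L ≤ K := inf_le_left
    have hLd : Module.finrank ℝ L = d := by
      have := finrank_inf_ker_add_one hψ
      rw [← hL] at this
      omega
    have hcodim : ∀ a ∈ K, a ∉ L → ∀ b ∈ K, ∃ r : ℝ, b - r • a ∈ L := by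
      intro a ha haL b hb
      have ha0 : ψ a ≠ 0 := fun h => haL ⟨ha, h⟩
      refine ⟨ψ b / ψ a, K.sub_mem hb (K.smul_mem _ ha), ?_⟩
      simp [ha0]
    obtain ⟨k, hk, hk0⟩ := hψ
    obtain ⟨φ, hφ, hφx⟩ := exists_dual_eq_one hxK
    have hlines : lineConesIn K ⊆ (AddSubgroup.closure (lineConesIn (Submodule.span ℝ {x} ⊔ K) ∪
        adaptedCones (d + 1) K x)).comap (extendByRay φ x) := by
      rintro _ ⟨A, hAfin, hAK, ⟨u, hu, hline⟩, rfl⟩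
      rw [SetLike.mem_coe, AddSubgroup.mem_comap,
        extendByRay_coneIndicator (fun z hz => hφ z (hAK hz)) hφx]
      refine AddSubgroup.subset_closure (Or.inl ⟨_, hAfin.insert x, ?_, ⟨u, hu, fun t => ?_⟩, rfl⟩)
      · exact Set.insert_subset (Submodule.mem_sup_left (Submodule.mem_span_singleton_self x))
          (hAK.trans (SetLike.coe_subset_coe.2 le_sup_right))
      · exact Submodule.span_mono (Set.subset_insert _ _) (hline t)
    rw [← extendByRay_coneIndicator (fun z hz => hφ z (hsK hz)) hφx, ← AddSubgroup.mem_comap]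
    refine (AddSubgroup.closure_le _).2 (Set.union_subset hlines ?_)
      (coneIndicator_mem_closure_oneOffCones hLK hcodim hk (fun h => hk0 h.2) hsK hs)
    rintro _ ⟨x', hx'K, hx'L, hx', A, hAL, hA, rfl⟩
    have hspan : Submodule.span ℝ {x'} ⊔ L = K := by
      refine le_antisymm (sup_le (by simpa using hx'K) hLK) fun b hb => ?_
      obtain ⟨r, hr⟩ := hcodim x' hx'K hx'L b hb
      exact Submodule.mem_sup.2 ⟨r • x', Submodule.mem_span_singleton.2 ⟨r, rfl⟩, _, hr, by simp⟩
    have hmem := ih hLd hx' hx'L hAL hA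
    rw [hspan] at hmem
    refine (AddSubgroup.closure_le _).2 (Set.union_subset hlines ?_) hmem
    rintro _ ⟨v, hv, rfl⟩
    have hvK : ∀ i, v i ∈ K := by
      intro i
      induction i using Fin.lastCases with
      | last => exact hv.last_eq ▸ hx'K
      | cast i => exact hLK (hv.span_eq ▸ Submodule.subset_span ⟨i, rfl⟩)
    refine AddSubgroup.subset_closure (Or.inr ⟨_, hv.snoc hspan
      (fun z hz => hψx z hz.1 hz.2) hx, ?_⟩)
    rw [genCone, extendByRay_coneIndicator (by rintro _ ⟨i, rfl⟩; exact hφ _ (hvK i)) hφx,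
      genCone_eq_hull_insert]
    simp

/-! ### The associated matrix -/

theorem assocMatrix_eq_of_signs {n : ℕ} {v : Fin n → EuclideanSpace ℝ (Fin n)}
    (hv : ∀ i, ‖v i‖ = 1) {ε : Fin n → ℝ} (hε : ∀ i, ε i = 1 ∨ ε i = -1)
    (hsign : ∀ i j, i ≠ j → ε i * ε j * inner ℝ (v i) (v j) ≤ 0) :
    assocMatrix v = Matrix.of fun i j => inner ℝ (ε i • v i) (ε j • v j) := by
  ext i j
  simp only [assocMatrix, Matrix.of_apply, real_inner_smul_left, real_inner_smul_right]
  have habs : ∀ i, |ε i| = 1 := fun i => by rcases hε i with h | h <;> simp [h]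
  split_ifs with hij
  · subst hij
    rw [real_inner_self_eq_norm_sq, hv i]
    rcases hε i with h | h <;> simp [h]
  · have h1 := hsign i j hij
    have h2 : |inner ℝ (v i) (v j)| = |ε i * ε j * inner ℝ (v i) (v j)| := by
      rw [abs_mul, abs_mul, habs, habs, one_mul, one_mul]
    rw [h2, abs_of_nonpos h1]
    ring

theorem dotProduct_gram_mulVec {n : ℕ} (u : Fin n → EuclideanSpace ℝ (Fin n)) (x : Fin n → ℝ) :
    x ⬝ᵥ (Matrix.of fun i j => inner ℝ (u i) (u j) : Matrix (Fin n) (Fin n) ℝ).mulVec x =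
      ‖∑ i, x i • u i‖ ^ 2 := by
  rw [← real_inner_self_eq_norm_sq, sum_inner]
  simp only [inner_sum, dotProduct, Matrix.mulVec, Matrix.of_apply, Finset.mul_sum,
    real_inner_smul_left, real_inner_smul_right]
  refine Finset.sum_congr rfl fun i _ => Finset.sum_congr rfl fun j _ => by ring

theorem posDef_gram {n : ℕ} {u : Fin n → EuclideanSpace ℝ (Fin n)} (hu : LinearIndependent ℝ u) :
    (Matrix.of fun i j => inner ℝ (u i) (u j) : Matrix (Fin n) (Fin n) ℝ).PosDef := by
  refine Matrix.PosDef.of_dotProduct_mulVec_pos ?_ fun x hx => ?_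
  · ext i j
    simp [real_inner_comm]
  · rw [star_trivial, dotProduct_gram_mulVec]
    have : ∑ i, x i • u i ≠ 0 := fun h =>
      hx (funext (Fintype.linearIndependent_iff.1 hu x h))
    positivity

/-! ### From group membership to signed sums -/

/-- An element of the subgroup generated by cones with lines and by the cones satisfying `P` is,
modulo cones with lines, a signed sum of cones satisfying `P`. -/
theorem exists_isDecomposition {n : ℕ} {P : PointedCone ℝ (EuclideanSpace ℝ (Fin n)) → Prop}
    {f : EuclideanSpace ℝ (Fin n) → ℤ} {H : Submodule ℝ (EuclideanSpace ℝ (Fin n))}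
    {S : Set (EuclideanSpace ℝ (Fin n) → ℤ)} (hS : ∀ g ∈ S, ∃ C, P C ∧ g = coneIndicator C)
    (hf : f ∈ AddSubgroup.closure (lineConesIn H ∪ S)) :
    ∃ (N : ℕ) (s : Fin N → ℤ) (C : Fin N → PointedCone ℝ (EuclideanSpace ℝ (Fin n))),
      (∀ i, s i = 1 ∨ s i = -1) ∧ f - ∑ i, s i • coneIndicator (C i) ∈ lineConeIndicators n ∧
        ∀ i, P (C i) := by
  induction hf using AddSubgroup.closure_induction with
  | mem f hf =>
    rcases hf with ⟨A, hA, -, hline, rfl⟩ | hf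
    · refine ⟨0, Fin.elim0, Fin.elim0, fun i => i.elim0, ?_, fun i => i.elim0⟩
      simpa [lineConeIndicators] using AddSubgroup.subset_closure
        (k := {f | ∃ K : PointedCone ℝ (EuclideanSpace ℝ (Fin n)),
          IsPolyhedralCone K ∧ ContainsLine K ∧ f = coneIndicator K})
        ⟨_, isPolyhedralCone_hull hA, hline, rfl⟩
    · obtain ⟨C, hC, rfl⟩ := hS f hf
      exact ⟨1, fun _ => 1, fun _ => C, fun _ => Or.inl rfl, by simp [zero_mem], fun _ => hC⟩
  | zero => exact ⟨0, Fin.elim0, Fin.elim0, fun i => i.elim0, by simp [zero_mem], fun i => i.elim0⟩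
  | add f g _ _ hf hg =>
    obtain ⟨N, s, C, hs, hmem, hP⟩ := hf
    obtain ⟨N', s', C', hs', hmem', hP'⟩ := hg
    refine ⟨N + N', Fin.append s s', Fin.append C C', fun i => ?_, ?_, fun i => ?_⟩
    · induction i using Fin.addCases with
      | left i => simpa using hs i
      | right i => simpa using hs' i
    · rw [Fin.sum_univ_add]
      simp only [Fin.append_left, Fin.append_right]
      rw [add_sub_add_comm]
      exact add_mem hmem hmem'
    · induction i using Fin.addCases with
      | left i => simpa using hP i
      | right i => simpa using hP' i
  | neg f _ hf =>
    obtain ⟨N, s, C, hs, hmem, hP⟩ := hf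
    refine ⟨N, fun i => -s i, C, fun i => ?_, ?_, hP⟩
    · rcases hs i with h | h <;> simp [h]
    · have := neg_mem hmem
      rw [neg_sub', ← Finset.sum_neg_distrib] at this
      simpa only [neg_smul] using this

theorem theorem2p3 (n : ℕ) (hn : 1 ≤ n) (w : Fin n → EuclideanSpace ℝ (Fin n))
    (hw : LinearIndependent ℝ w) (hw1 : ∀ i, ‖w i‖ = 1) :
    ∃ (N : ℕ) (s : Fin N → ℤ) (K : Fin N → PointedCone ℝ (EuclideanSpace ℝ (Fin n))),
      IsDecomposition (genCone w) s K ∧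
      ∀ m, (IsPolyhedralCone (K m) ∧ ContainsLine (K m)) ∨
        ∃ v : Fin n → EuclideanSpace ℝ (Fin n),
          K m = genCone v ∧ coneDim (K m) = n ∧ (assocMatrix v).PosDef ∧
            HasDecompProperties w v := by
  obtain ⟨d, rfl⟩ : ∃ d, n = d + 1 := ⟨n - 1, by omega⟩
  have hinit : LinearIndependent ℝ fun i : Fin d => w i.castSucc :=
    hw.comp _ (Fin.castSucc_injective d)
  have hxA : w (Fin.last d) ∉ Submodule.span ℝ (Set.range fun i : Fin d => w i.castSucc) := by
    have := hw.notMem_span_image (s := Set.range Fin.castSucc) (x := Fin.last d) (by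
      rintro ⟨i, hi⟩
      exact (Fin.castSucc_lt_last i).ne hi)
    rwa [← Set.range_comp] at this
  have hdim : Module.finrank ℝ (Submodule.span ℝ (Set.range fun i : Fin d => w i.castSucc)) = d := by
    simpa using finrank_span_eq_card hinit
  have hmem := coneIndicator_mem_closure_adaptedCones d hdim (hw1 _) hxA
    Submodule.subset_span hinit.linearIndepOn_id
  rw [← genCone_eq_hull_insert w] at hmem
  have hrange : ∀ v : Fin (d + 1) → EuclideanSpace ℝ (Fin (d + 1)),
      v '' {i | (i : ℕ) + 1 < d + 1} = Set.range fun i : Fin d => v i.castSucc := by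
    intro v
    ext z
    constructor
    · rintro ⟨i, hi, rfl⟩
      exact ⟨⟨i, by simpa using hi⟩, rfl⟩
    · rintro ⟨i, rfl⟩
      exact ⟨i.castSucc, by simp, rfl⟩
  have hlast : ∀ i : Fin (d + 1), (i : ℕ) + 1 = d + 1 → i = Fin.last d := fun i hi =>
    Fin.ext (by simpa using hi)
  obtain ⟨N, s, C, hs, hsum, hC⟩ := exists_isDecomposition (P := fun C =>
    ∃ v : Fin (d + 1) → EuclideanSpace ℝ (Fin (d + 1)),
      C = genCone v ∧ coneDim C = d + 1 ∧ (assocMatrix v).PosDef ∧ HasDecompProperties w v)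
    (by
      rintro _ ⟨v, hv, rfl⟩
      refine ⟨_, ⟨v, rfl, ?_⟩, rfl⟩
      have hspan : Submodule.span ℝ (Set.range v) = ⊤ := by
        rw [range_eq_insert_last v, hv.last_eq, Submodule.span_insert, hv.span_eq,
          ← Submodule.span_insert, ← range_eq_insert_last w]
        exact hw.span_eq_top_of_card_eq_finrank (by simp)
      have hli : LinearIndependent ℝ v :=
        linearIndependent_of_top_le_span_of_card_eq_finrank hspan.ge (by simp)
      obtain ⟨ε, hε, hsign⟩ := hv.exists_signs
      have hM := assocMatrix_eq_of_signs hv.norm_eq_one hε hsign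
      refine ⟨?_, ?_, hv.norm_eq_one, fun i hi => ?_, ?_, fun i j hi hj => ?_,
        ε, hε, fun y => ?_⟩
      · have : Submodule.span ℝ ((genCone v : PointedCone ℝ _) :
            Set (EuclideanSpace ℝ (Fin (d + 1)))) = ⊤ := by
          rw [eq_top_iff, ← hspan]
          exact Submodule.span_mono PointedCone.subset_hull
        rw [coneDim, this, finrank_top]
        simp
      · rw [hM]
        refine posDef_gram (Fintype.linearIndependent_iff.2 fun g hg i => ?_)
        simp only [smul_smul] at hg
        have := Fintype.linearIndependent_iff.1 hli _ hg i
        rcases hε i with h | h <;> simpa [h] using this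
      · rw [hlast i hi, hv.last_eq]
      · rw [hrange, hrange, hv.span_eq]
      · rw [hlast j hj, hv.last_eq]
        exact hv.inner_eq_zero ⟨i, by omega⟩ (by simp only; omega)
      · rw [hM, dotProduct_gram_mulVec]) hmem
  exact ⟨N, s, C, ⟨hs, hsum⟩, fun m => Or.inr (hC m)⟩
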